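/- Conventions. A family $\mathcal F$ of meromorphic functions on a domain $D\subseteq\mathbb C$ is \emph{normal} on $D$ if every sequence in $\mathcal F$ has a subsequence that converges uniformly on compact subsets of $D$ with respect to the spherical metric. For $h$ meromorphic in $\mathbb C$ put $\mathcal F_h=\{h(z+\omega):\omega\in\mathbb C\}$. Let $A\subset\mathbb C\cup\{\infty\}$, $B\subset\mathbb C\setminus\{0\}$ and $C=\{c_1,\dots,c_r\}\subset\mathbb C\cup\{\infty\}$ be pairwise disjoint finite sets with $|A|=n$, $|B|=s$, $|C|=r$, and let $m_1,\dots,m_r\ge2$ be integers. We say that a family $\mathcal F$ of meromorphic functions on $D$ satisfies the conditions $\mathcal N(A,B,C;m_1,\dots,m_r)$ if: (a) for every $z\in D$, either $f(z)\in A$ for all $f\in\mathcal F$ or $f(z)\notin A$ for all $f\in\mathcal F$; (b) for all $b\in B$, $f\in\mathcal F$, $z\in D$: $f(z)=b$ implies $f'(z)=b$; (c) if $c_j=\infty$, then every pole in $D$ of every $f\in\mathcal F$ has multiplicity at least $m_j$; if $c_j$ is finite, then there is a number $M_j$ such that for all $f\in\mathcal F$ and $z\in D$, $f(z)=c_j$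 implies $|f^{(k)}(z)|\le M_j$ for $k=1,\dots,m_j-1$. (The normality criterion in question says that these conditions together with $n+s+\sum_{j=1}^r(1-\frac1{m_j})>2$ imply that $\mathcal F$ is normal on $D$.) Write $\wp_\Lambda$ for the Weierstrass function of a lattice $\Lambda\subset\mathbb C$. **Theorem.** (1) Let $a,b$ be distinct nonzero complex numbers. There is a lattice $\Lambda$ for which $\wp:=\wp_\Lambda+\frac{a+b}3$ satisfies $(\wp')^2=4\wp(\wp-a)(\wp-b)$. For every such $\Lambda$ and $h(z)=\wp(e^z)$, all poles, zeros, $a$-points and $b$-points of every $f\in\mathcal F_h$ have multiplicity exactly $2$, and on every domain $D\subseteq\mathbb C$ the family $\mathcal F_h$ satisfies $\mathcal N(\emptyset,\emptyset,\{\infty,0,a,b\};2,2,2,2)$ but is not normal. (2) If moreover $b=-a$ (so that $\wp=\wp_\Lambda$) and $h(z)=(\wp(e^z))^2$, then all poles and zeros of every $f\in\mathcal F_h$ have multiplicity exactly $4$ and all its $a^2$-points have multiplicity exactly $2$, and on every domain $D$ the family $\mathcal F_h$ satisfies $\mathcal N(\emptyset,\emptyset,\{\infty,0,a^2\};4,4,2)$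 but is not normal. (3) Let $c\ne0$ be a complex number. There is a lattice $\Lambda$ for which $\wp:=\wp_\Lambda$ satisfies $(\wp')^2=4\wp^3+c$. For every such $\Lambda$, every square root $\sqrt c$ of $c$ and $h(z)=\wp'(e^z)$, all poles, $\sqrt c$-points and $(-\sqrt c)$-points of every $f\in\mathcal F_h$ have multiplicity exactly $3$, and on every domain $D$ the family $\mathcal F_h$ satisfies $\mathcal N(\emptyset,\emptyset,\{\infty,\sqrt c,-\sqrt c\};3,3,3)$ but is not normal. (4) With $\Lambda$ as in (3) and $h(z)=(\wp'(e^z))^2$, all poles of every $f\in\mathcal F_h$ have multiplicity exactly $6$, all its zeros exactly $2$ and all its $c$-points exactly $3$, and on every domain $D$ the family $\mathcal F_h$ satisfies $\mathcal N(\emptyset,\emptyset,\{\infty,0,c\};6,2,3)$ but is not normal. (5) Consequently the inequality $n+s+\sum_{j=1}^r(1-\frac1{m_j})>2$ in the criterion cannot be relaxed to $\ge2$: for $n=s=0$ and $(m_1,\dots,m_r)$ equal to $(2,2,2,2)$, $(4,4,2)$, $(3,3,3)$ or $(6,2,3)$ the left-hand side equals $2$, and on every domain $D$ there is a non-normal family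 that satisfies $\mathcal N(A,B,C;m_1,\dots,m_r)$ for some $A,B,C$ with $|A|=|B|=0$ and $|C|=r$. -/

import Mathlib

open scoped OnePoint

noncomputable section

namespace RamifiedFamilies

/-! Meromorphic functions on an open set `D` are functions `f : ℂ → ℂ` with `MeromorphicOn f D`.
The number that Lean assigns to `f` at a pole or a removable singularity carries no information:
every notion below depends only on `f` near the point with the point itself removed. -/

/-- The value in `ℂ ∪ {∞}` of a meromorphic function at `z`: `∞` at a pole, and otherwise the
value at `z` after removal of the singularity. -/
def sphVal (f : ℂ → ℂ) (z : ℂ) : OnePoint ℂ :=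
  open scoped Classical in
  if meromorphicOrderAt f z < 0 then ∞ else ((toMeromorphicNFAt f z z : ℂ) : OnePoint ℂ)

/-- The `k`-th derivative of a meromorphic function at a point `z` that is not a pole. -/
def derivAt (k : ℕ) (f : ℂ → ℂ) (z : ℂ) : ℂ :=
  iteratedDeriv k (toMeromorphicNFAt f z) z

/-- The multiplicity with which `f` takes the value `α` at an `α`-point `z`: the order of
vanishing at `z` of `f - α` if `α` is finite, and of `1 / f` if `α = ∞`. -/
def multAt (f : ℂ → ℂ) (z : ℂ) : OnePoint ℂ → WithTop ℤ
  | ∞ => meromorphicOrderAt (fun ζ => (f ζ)⁻¹) z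
  | (α : ℂ) => meromorphicOrderAt (fun ζ => f ζ - α) z

/-- The chordal distance on the Riemann sphere `ℂ ∪ {∞}`. -/
def chordal : OnePoint ℂ → OnePoint ℂ → ℝ
  | ∞, ∞ => 0
  | ∞, (w : ℂ) => 2 / √(1 + ‖w‖ ^ 2)
  | (z : ℂ), ∞ => 2 / √(1 + ‖z‖ ^ 2)
  | (z : ℂ), (w : ℂ) => 2 * ‖z - w‖ / (√(1 + ‖z‖ ^ 2) * √(1 + ‖w‖ ^ 2))

/-- A domain: a nonempty connected open set. -/
def IsDomainSet (D : Set ℂ) : Prop := IsOpen D ∧ IsConnected D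

/-- Normality on `D`: every sequence in `F` has a subsequence that converges uniformly on compact
subsets of `D` with respect to the spherical (chordal) metric. -/
def IsNormalFamily (D : Set ℂ) (F : Set (ℂ → ℂ)) : Prop :=
  ∀ u : ℕ → ℂ → ℂ, (∀ n, u n ∈ F) →
    ∃ φ : ℕ → ℕ, StrictMono φ ∧ ∃ g : ℂ → OnePoint ℂ,
      ∀ K : Set ℂ, K ⊆ D → IsCompact K → ∀ ε : ℝ, 0 < ε →
        ∃ N : ℕ, ∀ n : ℕ, N ≤ n → ∀ z ∈ K, chordal (sphVal (u (φ n)) z) (g z) < ε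

/-- The family `{ f(z + ω) : ω ∈ ℂ }` of all translates of `h`. -/
def translates (h : ℂ → ℂ) : Set (ℂ → ℂ) :=
  Set.range fun ω : ℂ => fun z : ℂ => h (z + ω)

/-- The conditions, apart from the numerical inequality, of the normality criterion, for a family
`F` of meromorphic functions on `D` and pairwise disjoint finite sets `A ⊆ ℂ ∪ {∞}`, `B ⊆ ℂ \ {0}`
and `C = {c 0, …, c (r - 1)} ⊆ ℂ ∪ {∞}`, where the value `c j` carries the integer `m j ≥ 2`. -/
structure CriterionConditions (D : Set ℂ) (F : Set (ℂ → ℂ)) (A : Finset (OnePoint ℂ))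
    (B : Finset ℂ) {r : ℕ} (c : Fin r → OnePoint ℂ) (m : Fin r → ℕ) : Prop where
  domain : IsDomainSet D
  meromorphic : ∀ f ∈ F, MeromorphicOn f D
  zero_notMem : (0 : ℂ) ∉ B
  injective : Function.Injective c
  disjoint_AB : ∀ b ∈ B, (b : OnePoint ℂ) ∉ A
  disjoint_AC : ∀ j, c j ∉ A
  disjoint_BC : ∀ b ∈ B, ∀ j, c j ≠ (b : OnePoint ℂ)
  two_le : ∀ j, 2 ≤ m j
  /-- (a) All members of `F` share the set `A`. -/
  share : ∀ z ∈ D, (∀ f ∈ F, sphVal f z ∈ A) ∨ (∀ f ∈ F, sphVal f z ∉ A)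
  /-- (b) `f = b` implies `f' = b`. -/
  deriv_eq : ∀ b ∈ B, ∀ f ∈ F, ∀ z ∈ D, sphVal f z = (b : OnePoint ℂ) → derivAt 1 f z = b
  /-- (c) If `∞` is one of the `c j`, then all poles have at least multiplicity `m j`. -/
  poles : ∀ j, c j = ∞ → ∀ f ∈ F, ∀ z ∈ D, sphVal f z = ∞ →
    (((m j : ℕ) : ℤ) : WithTop ℤ) ≤ multAt f z ∞
  /-- (c) At the `c j`-points, `c j` finite, the derivatives of orders `1, …, m j - 1` are bounded
  uniformly in `F`. -/
  deriv_le : ∀ j, c j ≠ ∞ → ∃ M : ℝ, ∀ f ∈ F, ∀ z ∈ D, sphVal f z = c j →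
    ∀ k : ℕ, 1 ≤ k → k < m j → ‖derivAt k f z‖ ≤ M

/-- The quantity `n + s + ∑ j, (1 - 1 / m j)`; the normality criterion requires it to be `> 2`. -/
def weight (n s : ℕ) {r : ℕ} (m : Fin r → ℕ) : ℝ :=
  n + s + ∑ j, (1 - 1 / (m j : ℝ))

/-- On every domain, the conditions of the normality criterion with the numbers `|A| = n`,
`|B| = s` and `m` (with `r` entries) are satisfied by some family that is not normal. -/
def AdmitsNonNormal (n s : ℕ) {r : ℕ} (m : Fin r → ℕ) : Prop :=
  ∀ D : Set ℂ, IsDomainSet D →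
    ∃ (F : Set (ℂ → ℂ)) (A : Finset (OnePoint ℂ)) (B : Finset ℂ) (c : Fin r → OnePoint ℂ),
      A.card = n ∧ B.card = s ∧ CriterionConditions D F A B c m ∧ ¬ IsNormalFamily D F

/-- The translates of `h` are meromorphic in `ℂ`, all their `c j`-points have multiplicity exactly
`m j`, and on every domain they form a non-normal family which satisfies the conditions of the
normality criterion with `A = B = ∅` and `C = {c 0, …, c (r - 1)}`. -/
structure IsRamifiedExample (h : ℂ → ℂ) {r : ℕ} (c : Fin r → OnePoint ℂ) (m : Fin r → ℕ) :
    Prop where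
  meromorphic : ∀ f ∈ translates h, MeromorphicOn f Set.univ
  multiplicity : ∀ f ∈ translates h, ∀ j, ∀ z : ℂ, sphVal f z = c j →
    multAt f z (c j) = (((m j : ℕ) : ℤ) : WithTop ℤ)
  conditions : ∀ D : Set ℂ, IsDomainSet D → CriterionConditions D (translates h) ∅ ∅ c m
  not_normal : ∀ D : Set ℂ, IsDomainSet D → ¬ IsNormalFamily D (translates h)

/-- The Weierstrass function of the lattice `L`, normalised by an additive constant so that the
cubic in its differential equation may have the roots `0`, `a`, `b`. (The roots of the cubic
`4 x ^ 3 - g₂ x - g₃` of `℘` itself have the sum `0`, so that `(a + b) / 3` is the only possible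
constant; it is `0` if `b = -a`.) -/
def wpShift (L : PeriodPair) (a b : ℂ) (z : ℂ) : ℂ := L.weierstrassP z + (a + b) / 3

/-- The differential equation `℘'² = 4 ℘ (℘ - a) (℘ - b)`, away from the poles. -/
def HasRoots (L : PeriodPair) (a b : ℂ) : Prop :=
  ∀ z ∉ L.lattice, L.derivWeierstrassP z ^ 2 =
    4 * wpShift L a b z * (wpShift L a b z - a) * (wpShift L a b z - b)

/-- The differential equation `℘'² = 4 ℘³ + c`, away from the poles. -/
def IsEquianharmonic (L : PeriodPair) (c : ℂ) : Prop :=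
  ∀ z ∉ L.lattice, L.derivWeierstrassP z ^ 2 = 4 * L.weierstrassP z ^ 3 + c

end RamifiedFamilies

end

/-! An elliptic function H can be totally ramified over a set of values whose weights 1 - 1/m add up
to exactly 2. Squaring `℘'² = 4℘(℘ - a)(℘ - b)` or `℘'² = 4℘³ + c` against orders of vanishing gives
the multiplicities: a simple root of the cubic is taken doubly by `℘`, and a zero of `℘` with `℘' ≠
0` is a triple zero of `℘'² - c`. Squaring H yields the two remaining types. Since `exp` has no
critical points, the translates of H ∘ exp keep these multiplicities, and at finite values the lower
derivatives vanish, so the conditions hold with bound 0 (`isRamifiedExample_comp_exp`).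

H itself has a bounded spherical derivative, so its own translates would be normal; composing with
`exp` destroys this. Translating by log(nω) - z₀ turns H ∘ exp into H(nω e^(z - z₀)), which for a
period ω has a pole at z₀ and takes a fixed finite value at points tending to z₀. No subsequence can
converge uniformly near z₀ (`not_isNormalFamily_translates`).

The lattices come from `PeriodPair.exists_invariants`: every pair of invariants with nonzero
discriminant occurs. A modular form of weight 12 must have a zero, which fixes the ratio g₂³ : g₃²;
rescaling the lattice then adjusts the invariants themselves. -/

/-! ### Lattices with prescribed invariants. -/

section Lattices

open UpperHalfPlane ModularForm EisensteinSeries MatrixGroups Filter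
open scoped Topology

/-- A modular form of level one tends to its constant coefficient at the cusp. -/
theorem ModularForm.tendsto_atImInfty_qExpansion_coeff_zero {k : ℤ} (f : ModularForm 𝒮ℒ k) :
    Tendsto f atImInfty (𝓝 ((qExpansion 1 f).coeff 0)) := by
  have hf := ModularFormClass.analyticAt_cuspFunction_zero f one_pos one_mem_strictPeriods_SL
  have h := hf.continuousAt.tendsto.comp (qParam_tendsto_atImInfty one_pos)
  have h0 : (qExpansion 1 f).coeff 0 = cuspFunction 1 f 0 := by
    simp [qExpansion_coeff]
  rw [h0]
  refine h.congr fun τ => ?_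
  exact SlashInvariantFormClass.eq_cuspFunction f τ one_mem_strictPeriods_SL one_ne_zero

/-- A level one form of positive weight which does not vanish at the cusp has a zero. -/
theorem ModularForm.exists_eq_zero_of_tendsto {k : ℤ} (hk : 0 < k) (f : ModularForm 𝒮ℒ k) {c : ℂ}
    (hc : c ≠ 0) (hf : Tendsto f atImInfty (𝓝 c)) : ∃ τ, f τ = 0 := by
  by_contra! hne
  have hslash (γ : SL(2, ℤ)) : (fun z => 1 / f z) ∣[-k] γ = fun z => 1 / f z := by
    have hγ : (γ : GL (Fin 2) ℝ) ∈ 𝒮ℒ := ⟨γ, rfl⟩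
    change ((1 : ℍ → ℂ) / ⇑f) ∣[-k] γ = 1 / ⇑f
    rw [← zero_sub, div_slash_SL2, is_invariant_one, SL_slash,
      SlashInvariantFormClass.slash_action_eq f _ hγ]
  -- Without zeros of f, 1/f is holomorphic, and the nonzero limit c bounds it at the cusp. It is
  -- then a form of negative weight, hence zero, which a reciprocal cannot be.
  let g : ModularForm 𝒮ℒ (-k) :=
    { toFun z := 1 / f z
      slash_action_eq' := fun _ ⟨γ, hγ⟩ => hγ ▸ hslash γ
      holo' := mdifferentiable_const.div f.holo' hne
      bdd_at_cusps' {c'} hc' := by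
        rw [Subgroup.IsArithmetic.isCusp_iff_isCusp_SL2Z] at hc'
        rw [OnePoint.isBoundedAt_iff_forall_SL2Z hc']
        intro γ _
        rw [hslash γ]
        simp only [one_div]
        exact (hf.inv₀ hc).isBigO_one ℝ }
  have hg : (g : ℍ → ℂ) = 0 := ModularFormClass.levelOne_neg_weight_eq_zero (by lia) g
  have h1 : 1 / f UpperHalfPlane.I = 0 := congrFun hg UpperHalfPlane.I
  simp [hne] at h1

/-- The form y E₄³ - x E₆² has constant term y - x ≠ 0 at the cusp, so it has a zero. This plays the
role of the surjectivity of the j-invariant. -/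
theorem exists_mul_E₄_cube_eq_mul_E₆_sq {x y : ℂ} (h : x ≠ y) :
    ∃ τ : ℍ, y * E₄ τ ^ 3 = x * E₆ τ ^ 2 := by
  let f : ModularForm 𝒮ℒ 12 :=
    y • ModularForm.mcast (by decide) (E₄.pow 3) - x • ModularForm.mcast (by decide) (E₆.pow 2)
  have hf (z : ℍ) : f z = y * E₄ z ^ 3 - x * E₆ z ^ 2 := by
    simp only [f, _root_.sub_apply, _root_.smul_apply, ModularForm.coe_mcast,
      ModularForm.coe_pow, Pi.pow_apply, smul_eq_mul]
  have h4 := E₄.tendsto_atImInfty_qExpansion_coeff_zero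
  have h6 := E₆.tendsto_atImInfty_qExpansion_coeff_zero
  rw [E_qExpansion_coeff_zero _ ⟨2, rfl⟩] at h4
  rw [E_qExpansion_coeff_zero _ ⟨3, rfl⟩] at h6
  obtain ⟨τ, hτ⟩ := f.exists_eq_zero_of_tendsto (by norm_num) (c := y - x)
    (sub_ne_zero.mpr h.symm) (by
      have := ((h4.pow 3).const_mul y).sub ((h6.pow 2).const_mul x)
      simp only [one_pow, mul_one] at this
      exact this.congr fun z => (hf z).symm)
  exact ⟨τ, sub_eq_zero.mp ((hf τ).symm.trans hτ)⟩

/-- The pair of periods `(ω τ, ω)`. -/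
noncomputable def PeriodPair.ofUpperHalfPlane (τ : ℍ) (ω : ℂ) (hω : ω ≠ 0) : PeriodPair where
  ω₁ := ω * τ
  ω₂ := ω
  indep := by
    rw [LinearIndependent.pair_iff]
    intro s t hst
    have h : (s * τ + t : ℂ) = 0 := by
      have : ω * (s * τ + t : ℂ) = 0 := by
        rw [← hst]; simp only [Complex.real_smul]; ring
      simpa [hω] using this
    have him := congrArg Complex.im h
    have hs : s = 0 := by simpa [τ.im_ne_zero] using him
    subst hs
    simpa using h

/-- Homogeneity of lattice sums pulls out ω; the factor 2ζ(k) arises because `E` is normalised to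
constant term 1. -/
theorem PeriodPair.G_ofUpperHalfPlane (τ : ℍ) {ω : ℂ} (hω : ω ≠ 0) {k : ℕ} (hk : 3 ≤ k) :
    (ofUpperHalfPlane τ ω hω).G k = (ω⁻¹) ^ k * (2 * riemannZeta k * E hk τ) := by
  have hE : E hk τ = (1 / 2 : ℂ) * eisensteinSeries (N := 1) 0 k τ := rfl
  have h := tsum_eisSummand_eq_riemannZeta_mul_eisensteinSeries hk τ
  have : 2 * riemannZeta k * E hk τ = ∑' v : Fin 2 → ℤ, eisSummand k v τ := by
    rw [h, hE]; ring
  rw [this, G, ← (ofUpperHalfPlane τ ω hω).latticeEquivProd.symm.toEquiv.tsum_eq,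
    ← (finTwoArrowEquiv ℤ).tsum_eq, ← tsum_mul_left]
  refine tsum_congr fun v => ?_
  have hv : ((ofUpperHalfPlane τ ω hω).latticeEquivProd.symm (v 0, v 1) : ℂ) =
      ω * (v 0 * τ + v 1) := by
    rw [latticeEquiv_symm_apply]
    simp only [ofUpperHalfPlane]
    ring
  change (((ofUpperHalfPlane τ ω hω).latticeEquivProd.symm (v 0, v 1) : ℂ) ^ k)⁻¹ = _
  rw [hv, eisSummand, zpow_neg, zpow_natCast, mul_pow, mul_inv, inv_pow]

theorem riemannZeta_six : riemannZeta 6 = (Real.pi : ℂ) ^ 6 / 945 := by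
  have h := riemannZeta_two_mul_nat (k := 3) (by norm_num)
  have hb : bernoulli 6 = 1 / 42 := by
    rw [bernoulli_eq_bernoulli'_of_ne_one (by norm_num)]
    rw [bernoulli'_def]
    have h5 : bernoulli' 5 = 0 := bernoulli'_eq_zero_of_odd (by decide) (by norm_num)
    norm_num [Finset.sum_range_succ, h5, Nat.choose]
  norm_num [hb, Nat.factorial] at h
  rw [h]; ring

/-- Every pair with nonzero discriminant is the pair of invariants of a lattice. -/
theorem PeriodPair.exists_invariants {p q : ℂ} (h : p ^ 3 ≠ 27 * q ^ 2) :
    ∃ L : PeriodPair, L.g₂ = p ∧ L.g₃ = q := by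
  obtain ⟨τ, hτ⟩ := exists_mul_E₄_cube_eq_mul_E₆_sq h
  -- P and Q are the invariants g₂ = 60 G₄ and g₃ = 140 G₆ of the lattice spanned by τ and 1.
  set P : ℂ := 4 * (Real.pi : ℂ) ^ 4 / 3 * E₄ τ with hP
  set Q : ℂ := 8 * (Real.pi : ℂ) ^ 6 / 27 * E₆ τ with hQ
  have hπ : (Real.pi : ℂ) ≠ 0 := by exact_mod_cast Real.pi_ne_zero
  have hne : P ^ 3 ≠ 27 * Q ^ 2 := by
    intro he
    refine discriminant_ne_zero τ ?_
    rw [discriminant_eq_E₄_cube_sub_E₆_sq]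
    have : (64 * (Real.pi : ℂ) ^ 12 / 27) * (E₄ τ ^ 3 - E₆ τ ^ 2) = 0 := by
      rw [hP, hQ] at he
      linear_combination he
    rw [(mul_eq_zero.mp this).resolve_left (by simp [hπ]), zero_div]
  have hPQ : q ^ 2 * P ^ 3 = p ^ 3 * Q ^ 2 := by
    rw [hP, hQ]
    linear_combination (64 * (Real.pi : ℂ) ^ 12 / 729) * hτ
  -- Scaling the lattice by 1/t multiplies g₂ by t⁴ and g₃ by t⁶. If p and q are both nonzero,
  -- dividing the two equations forces t² = qP/(pQ), and `hPQ` makes this sufficient; if one of them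
  -- vanishes, a sixth or a fourth root does.
  have key : ∃ t : ℂ, t ≠ 0 ∧ t ^ 4 * P = p ∧ t ^ 6 * Q = q := by
    by_cases hp : p = 0
    · subst hp
      have hq : q ≠ 0 := by rintro rfl; simp at h
      have hP0 : P = 0 := by simpa [hq] using hPQ
      have hQ0 : Q ≠ 0 := by intro hQ0; simp [hP0, hQ0] at hne
      obtain ⟨t, ht⟩ := IsAlgClosed.exists_pow_nat_eq (q / Q) (n := 6) (by norm_num)
      refine ⟨t, ?_, by simp [hP0], by rw [ht]; field_simp⟩
      rintro rfl
      simp [hQ0, eq_div_iff] at ht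
      exact hq ht.symm
    · have hP0 : P ≠ 0 := by
        intro hP0
        have : Q = 0 := by simpa [hP0, hp] using hPQ
        simp [hP0, this] at hne
      by_cases hq : q = 0
      · subst hq
        have hQ0 : Q = 0 := by simpa [hp] using hPQ
        obtain ⟨t, ht⟩ := IsAlgClosed.exists_pow_nat_eq (p / P) (n := 4) (by norm_num)
        refine ⟨t, ?_, by rw [ht]; field_simp, by simp [hQ0]⟩
        rintro rfl
        simp [hP0, eq_div_iff] at ht
        exact hp ht.symm
      · have hQ0 : Q ≠ 0 := by
          intro hQ0
          simp [hQ0, hq, hP0] at hPQ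
        obtain ⟨t, ht⟩ := IsAlgClosed.exists_pow_nat_eq (q * P / (p * Q)) (n := 2) (by norm_num)
        refine ⟨t, ?_, ?_, ?_⟩
        · rintro rfl
          simp [hp, hP0, hq, hQ0, eq_div_iff] at ht
        · rw [show t ^ 4 = (t ^ 2) ^ 2 by ring, ht]
          field_simp
          linear_combination hPQ
        · rw [show t ^ 6 = (t ^ 2) ^ 3 by ring, ht]
          field_simp
          linear_combination hPQ
  obtain ⟨t, ht, h2, h3⟩ := key
  refine ⟨ofUpperHalfPlane τ t⁻¹ (inv_ne_zero ht), ?_, ?_⟩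
  · rw [← h2, g₂, G_ofUpperHalfPlane τ _ (by norm_num : 3 ≤ 4), inv_inv, hP]
    push_cast
    rw [riemannZeta_four]
    ring
  · rw [← h3, g₃, G_ofUpperHalfPlane τ _ (by norm_num : 3 ≤ 6), inv_inv, hQ]
    push_cast
    rw [riemannZeta_six]
    ring

end Lattices

noncomputable section

namespace RamifiedFamilies

open Filter
open scoped Topology

/-! ### Spherical values, multiplicities and composition with locally injective maps. -/

section Values

theorem sphVal_of_analyticAt {f : ℂ → ℂ} {z : ℂ} (hf : AnalyticAt ℂ f z) :
    sphVal f z = (f z : OnePoint ℂ) := by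
  rw [sphVal, if_neg hf.meromorphicOrderAt_nonneg.not_gt,
    toMeromorphicNFAt_eq_self.2 hf.meromorphicNFAt]

theorem sphVal_of_pole {f : ℂ → ℂ} {z : ℂ} (hf : meromorphicOrderAt f z < 0) :
    sphVal f z = ∞ := by
  rw [sphVal, if_pos hf]

theorem derivAt_of_analyticAt {f : ℂ → ℂ} {z : ℂ} (hf : AnalyticAt ℂ f z) (k : ℕ) :
    derivAt k f z = iteratedDeriv k f z := by
  rw [derivAt, toMeromorphicNFAt_eq_self.2 hf.meromorphicNFAt]

theorem multAt_infty (f : ℂ → ℂ) (z : ℂ) : multAt f z ∞ = -meromorphicOrderAt f z :=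
  meromorphicOrderAt_inv

theorem multAt_coe (f : ℂ → ℂ) (z α : ℂ) :
    multAt f z (α : OnePoint ℂ) = meromorphicOrderAt (fun ζ => f ζ - α) z :=
  rfl

theorem multAt_comp {H g : ℂ → ℂ} {z : ℂ} (hg : AnalyticAt ℂ g z) (hg' : deriv g z ≠ 0)
    (α : OnePoint ℂ) : multAt (H ∘ g) z α = multAt H (g z) α := by
  induction α using OnePoint.rec with
  | infty => rw [multAt_infty, multAt_infty, meromorphicOrderAt_comp_of_deriv_ne_zero hg hg']
  | coe α =>
    rw [multAt_coe, multAt_coe, ← meromorphicOrderAt_comp_of_deriv_ne_zero hg hg']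
    rfl

/-- At an `α`-point of multiplicity `m` the derivatives of orders `1, …, m - 1` vanish. -/
theorem iteratedDeriv_eq_zero_of_multAt_eq {f : ℂ → ℂ} {z α : ℂ} (hf : AnalyticAt ℂ f z) {m : ℕ}
    (hm : multAt f z (α : OnePoint ℂ) = (((m : ℕ) : ℤ) : WithTop ℤ)) {k : ℕ} (hk : 1 ≤ k)
    (hkm : k < m) : iteratedDeriv k f z = 0 := by
  have ha : AnalyticAt ℂ (fun ζ => f ζ - α) z := hf.sub analyticAt_const
  rw [multAt_coe, ha.meromorphicOrderAt_eq] at hm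
  have ho : analyticOrderAt (fun ζ => f ζ - α) z = m := by
    cases h : analyticOrderAt (fun ζ => f ζ - α) z with
    | top => simp [h] at hm
    | coe n =>
      rw [h] at hm
      simpa using hm
  have := (natCast_le_analyticOrderAt_iff_iteratedDeriv_eq_zero ha).mp ho.ge k hkm
  rw [iteratedDeriv_fun_sub hf.contDiffAt contDiffAt_const, iteratedDeriv_const,
    if_neg (by lia), sub_zero] at this
  exact this

end Values

/-- `H` is meromorphic in the plane, and every point is a pole or a point of analyticity. -/
def IsAnalyticOrPole (H : ℂ → ℂ) : Prop :=
  ∀ w, AnalyticAt ℂ H w ∨ meromorphicOrderAt H w < 0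

namespace IsAnalyticOrPole

variable {H : ℂ → ℂ}

theorem meromorphicAt (hH : IsAnalyticOrPole H) (w : ℂ) : MeromorphicAt H w :=
  (hH w).elim AnalyticAt.meromorphicAt
    fun h => meromorphicAt_of_meromorphicOrderAt_ne_zero h.ne

theorem analyticAt_of_sphVal_eq (hH : IsAnalyticOrPole H) {w α : ℂ}
    (h : sphVal H w = (α : OnePoint ℂ)) : AnalyticAt ℂ H w ∧ H w = α := by
  rcases hH w with ha | hp
  · rw [sphVal_of_analyticAt ha] at h
    exact ⟨ha, OnePoint.coe_injective h⟩
  · rw [sphVal_of_pole hp] at h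
    exact absurd h (OnePoint.infty_ne_coe α)

theorem order_neg_of_sphVal_eq (hH : IsAnalyticOrPole H) {w : ℂ} (h : sphVal H w = ∞) :
    meromorphicOrderAt H w < 0 := by
  rcases hH w with ha | hp
  · rw [sphVal_of_analyticAt ha] at h
    exact absurd h (OnePoint.coe_ne_infty _)
  · exact hp

theorem comp (hH : IsAnalyticOrPole H) {g : ℂ → ℂ} (hg : ∀ z, AnalyticAt ℂ g z)
    (hg' : ∀ z, deriv g z ≠ 0) : IsAnalyticOrPole (H ∘ g) := by
  intro z
  rcases hH (g z) with ha | hp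
  · exact .inl (ha.comp (hg z))
  · exact .inr (by rwa [meromorphicOrderAt_comp_of_deriv_ne_zero (hg z) (hg' z)])

theorem sphVal_comp (hH : IsAnalyticOrPole H) {g : ℂ → ℂ} {z : ℂ} (hg : AnalyticAt ℂ g z)
    (hg' : deriv g z ≠ 0) : sphVal (H ∘ g) z = sphVal H (g z) := by
  rcases hH (g z) with ha | hp
  · rw [sphVal_of_analyticAt ha, sphVal_of_analyticAt (ha.comp hg), Function.comp_apply]
  · rw [sphVal_of_pole hp, sphVal_of_pole]
    rwa [meromorphicOrderAt_comp_of_deriv_ne_zero hg hg']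

end IsAnalyticOrPole

/-! ### A Lipschitz test function on the sphere. -/

section Chordal

/-- A continuous function on the sphere that vanishes exactly at `∞`. -/
def proximity : OnePoint ℂ → ℝ
  | ∞ => 0
  | (z : ℂ) => 1 / (1 + ‖z‖ ^ 2)

theorem proximity_infty : proximity ∞ = 0 := rfl

theorem proximity_coe (z : ℂ) : proximity (z : OnePoint ℂ) = 1 / (1 + ‖z‖ ^ 2) := rfl

/-- Chordal estimates thereby become estimates between real numbers, and no triangle inequality for
`chordal` is needed. -/
theorem abs_proximity_sub_le (p q : OnePoint ℂ) : |proximity p - proximity q| ≤ chordal p q := by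
  have aux (z : ℂ) : 1 / (1 + ‖z‖ ^ 2) ≤ 2 / √(1 + ‖z‖ ^ 2) := by
    have h1 : 1 ≤ √(1 + ‖z‖ ^ 2) := Real.one_le_sqrt.mpr (by nlinarith [norm_nonneg z])
    have h2 : √(1 + ‖z‖ ^ 2) ^ 2 = 1 + ‖z‖ ^ 2 := Real.sq_sqrt (by positivity)
    rw [div_le_div_iff₀ (by positivity) (by positivity)]
    nlinarith
  induction p using OnePoint.rec with
  | infty =>
    induction q using OnePoint.rec with
    | infty => simp [proximity, chordal]
    | coe w =>
      rw [proximity_infty, proximity_coe, zero_sub, abs_neg, abs_of_nonneg (by positivity)]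
      exact aux w
  | coe z =>
    induction q using OnePoint.rec with
    | infty =>
      rw [proximity_infty, proximity_coe, sub_zero, abs_of_nonneg (by positivity)]
      exact aux z
    | coe w =>
      rw [proximity_coe, proximity_coe]
      change _ ≤ 2 * ‖z - w‖ / (√(1 + ‖z‖ ^ 2) * √(1 + ‖w‖ ^ 2))
      set a := ‖z‖
      set b := ‖w‖
      have ha : 0 ≤ a := norm_nonneg z
      have hb : 0 ≤ b := norm_nonneg w
      have hd : |b - a| ≤ ‖z - w‖ := by
        rw [abs_sub_comm]; exact abs_norm_sub_norm_le z w
      set s := √(1 + a ^ 2) * √(1 + b ^ 2)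
      have hs : s ^ 2 = (1 + a ^ 2) * (1 + b ^ 2) := by
        rw [mul_pow, Real.sq_sqrt (by positivity), Real.sq_sqrt (by positivity)]
      have hs0 : 0 < s := by positivity
      -- (1 + a²)(1 + b²) = (a + b)² + (ab - 1)².
      have hab : a + b ≤ s := by
        refine abs_le_of_sq_le_sq' ?_ hs0.le |>.2
        rw [hs]
        nlinarith [sq_nonneg (a * b - 1)]
      have : 1 / (1 + a ^ 2) - 1 / (1 + b ^ 2) = (b - a) * (a + b) / s ^ 2 := by
        rw [hs]
        field_simp
        ring
      rw [this, abs_div, abs_mul, abs_of_nonneg (add_nonneg ha hb), abs_of_pos (pow_pos hs0 2),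
        div_le_div_iff₀ (by positivity) hs0]
      calc |b - a| * (a + b) * s ≤ ‖z - w‖ * s * s := by gcongr
        _ = ‖z - w‖ * s ^ 2 := by ring
        _ ≤ 2 * ‖z - w‖ * s ^ 2 := by
          gcongr
          linarith [norm_nonneg (z - w)]

theorem IsAnalyticOrPole.tendsto_proximity_of_pole {f : ℂ → ℂ} (hf : IsAnalyticOrPole f) {z : ℂ}
    (hz : meromorphicOrderAt f z < 0) :
    Tendsto (fun ζ => proximity (sphVal f ζ)) (𝓝 z) (𝓝 0) := by
  have hp : Tendsto (fun ζ => 1 / (1 + ‖f ζ‖ ^ 2)) (𝓝[≠] z) (𝓝 0) := by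
    have h := tendsto_norm_atTop_iff_cobounded.mpr (tendsto_cobounded_of_meromorphicOrderAt_neg hz)
    simp only [one_div]
    exact tendsto_inv_atTop_zero.comp
      (tendsto_atTop_add_const_left _ 1 ((tendsto_pow_atTop two_ne_zero).comp h))
  have hp' : Tendsto (fun ζ => proximity (sphVal f ζ)) (𝓝[≠] z) (𝓝 0) := by
    refine hp.congr' ?_
    filter_upwards [(hf.meromorphicAt z).eventually_analyticAt] with ζ hζ
    rw [sphVal_of_analyticAt hζ, proximity_coe]
  rw [← nhdsNE_sup_pure z]
  refine hp'.sup ?_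
  rw [tendsto_pure_left]
  intro s hs
  rw [sphVal_of_pole hz, proximity_infty]
  exact mem_of_mem_nhds hs

end Chordal

/-! ### Failure of normality. -/

section NotNormal

/-- The translates of `H ∘ exp`, for a periodic function `H` with a pole at `0`, are not
normal in any neighbourhood of any point. -/
theorem not_isNormalFamily_translates {H : ℂ → ℂ} (hH : IsAnalyticOrPole H) {ω : ℂ} (hω : ω ≠ 0)
    (hper : Function.Periodic H ω) (h0 : meromorphicOrderAt H 0 < 0) {D : Set ℂ}
    (hD : IsDomainSet D) : ¬ IsNormalFamily D (translates fun z => H (Complex.exp z)) := by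
  intro hN
  obtain ⟨z₀, hz₀⟩ := hD.2.nonempty
  obtain ⟨p, hp⟩ : ∃ p, AnalyticAt ℂ H p := ((hH.meromorphicAt 0).eventually_analyticAt).exists
  have hperN (n : ℕ) (z : ℂ) : H (n * ω + z) = H z := by
    rw [add_comm]; exact hper.nat_mul n z
  have ordN (n : ℕ) : meromorphicOrderAt H (n * ω) < 0 := by
    have hshift : H ∘ (· + (n * ω : ℂ)) = H := by
      ext z; simp [add_comm z, hperN]
    have := meromorphicOrderAt_comp_add_const_eq_meromorphicOrderAt (x := 0) (c := n * ω) (f := H)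
    rw [hshift, zero_add] at this
    rwa [← this]
  -- The translation is chosen so that z₀ is sent to the period (n + 1)ω, a pole of H; n + 1 instead
  -- of n keeps the argument of the logarithm nonzero.
  let g (n : ℕ) (z : ℂ) : ℂ := Complex.exp (z + (Complex.log ((n + 1 : ℕ) * ω) - z₀))
  have hn0 (n : ℕ) : ((n + 1 : ℕ) * ω : ℂ) ≠ 0 :=
    mul_ne_zero (Nat.cast_ne_zero.mpr n.succ_ne_zero) hω
  have hgexp (n : ℕ) (z : ℂ) : g n z = (n + 1 : ℕ) * ω * Complex.exp (z - z₀) := by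
    simp only [g]
    rw [show z + (Complex.log ((n + 1 : ℕ) * ω) - z₀) =
      Complex.log ((n + 1 : ℕ) * ω) + (z - z₀) by ring, Complex.exp_add, Complex.exp_log (hn0 n)]
  have hgan (n : ℕ) (z : ℂ) : AnalyticAt ℂ (g n) z := by fun_prop
  have hgd (n : ℕ) (z : ℂ) : deriv (g n) z ≠ 0 := by
    have : HasDerivAt (g n) (g n z * 1) z := ((hasDerivAt_id z).add_const _).cexp
    rw [this.deriv, mul_one]
    exact Complex.exp_ne_zero _
  let f (n : ℕ) : ℂ → ℂ := H ∘ g n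
  have hf (n : ℕ) : IsAnalyticOrPole (f n) := hH.comp (hgan n) (hgd n)
  have hfz (n : ℕ) : meromorphicOrderAt (f n) z₀ < 0 := by
    rw [meromorphicOrderAt_comp_of_deriv_ne_zero (hgan n z₀) (hgd n z₀), hgexp, sub_self,
      Complex.exp_zero, mul_one]
    exact ordN _
  obtain ⟨φ, hφ, G, hG⟩ := hN f fun n => ⟨_, rfl⟩
  obtain ⟨r, hr, hrD⟩ := Metric.nhds_basis_closedBall.mem_iff.mp (hD.1.mem_nhds hz₀)
  set η : ℝ := 1 / (1 + ‖H p‖ ^ 2) with hη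
  have hη0 : 0 < η := by positivity
  obtain ⟨N, hNn⟩ := hG _ hrD (isCompact_closedBall z₀ r) (η / 4) (by positivity)
  -- One fixed member of the subsequence stands in for the limit G, about whose continuity nothing
  -- is known: near its pole z₀ its values stay close to ∞.
  have hsmall : ∀ᶠ z in 𝓝 z₀, proximity (sphVal (f (φ N)) z) < η / 4 :=
    ((hf _).tendsto_proximity_of_pole (hfz _)).eventually_lt_const (by positivity)
  -- the `H p`-points `z n` of `f n` accumulate at `z₀`
  let z (n : ℕ) : ℂ := z₀ + Complex.log (1 + p / ((n + 1 : ℕ) * ω))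
  have hlim : Tendsto (fun n : ℕ => 1 + p / ((n + 1 : ℕ) * ω)) atTop (𝓝 1) := by
    have h1 : Tendsto (fun n : ℕ => p / ω * (1 / ((n : ℂ) + 1))) atTop (𝓝 (p / ω * 0)) :=
      (tendsto_one_div_add_atTop_nhds_zero_nat (𝕜 := ℂ)).const_mul _
    rw [mul_zero] at h1
    have h2 := h1.const_add 1
    rw [add_zero] at h2
    refine h2.congr fun n => ?_
    push_cast
    rw [div_mul_div_comm, mul_one, mul_comm ω]
  have hz : Tendsto z atTop (𝓝 z₀) := by
    have := ((continuousAt_clog Complex.one_mem_slitPlane).tendsto.comp hlim).const_add z₀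
    rwa [Complex.log_one, add_zero] at this
  have hzφ := hz.comp hφ.tendsto_atTop
  obtain ⟨n, hn1, hn2, hn3, hn4⟩ := ((hzφ.eventually hsmall).and
    ((hzφ.eventually (Metric.closedBall_mem_nhds z₀ hr)).and
      (((hlim.comp hφ.tendsto_atTop).eventually_ne one_ne_zero).and
        (eventually_ge_atTop N)))).exists
  simp only [Function.comp_apply] at hn1 hn2 hn3
  have hgz : g (φ n) (z (φ n)) = (φ n + 1 : ℕ) * ω + p := by
    rw [hgexp, show z (φ n) - z₀ = Complex.log (1 + p / ((φ n + 1 : ℕ) * ω)) by simp [z],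
      Complex.exp_log hn3, mul_add, mul_one, mul_div_cancel₀ _ (hn0 _)]
  have hval : sphVal (f (φ n)) (z (φ n)) = (H p : OnePoint ℂ) := by
    have hshift : H ∘ (fun w => w - ((φ n + 1 : ℕ) * ω : ℂ)) = H := by
      ext w
      rw [Function.comp_apply, ← hperN (φ n + 1), add_sub_cancel]
    have han : AnalyticAt ℂ H ((φ n + 1 : ℕ) * ω + p) := by
      rw [← hshift]
      exact AnalyticAt.comp (by simpa using hp) (by fun_prop)
    rw [hH.sphVal_comp (hgan _ _) (hgd _ _), hgz, sphVal_of_analyticAt han, hperN]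
  -- At the point z (φ n), both f (φ n) and f (φ N) have proximity within η/4 of that of G. The
  -- first has proximity η and the second less than η/4, so η < 3η/4.
  have hA := (abs_proximity_sub_le _ _).trans_lt (hNn n hn4 _ hn2)
  have hB := (abs_proximity_sub_le _ _).trans_lt (hNn N le_rfl _ hn2)
  rw [hval, proximity_coe, ← hη, abs_lt] at hA
  rw [abs_lt] at hB
  linarith [hA.2, hB.1, hn1]

end NotNormal

/-- A periodic function with a pole at `0` which takes each of the values `c j` only with the
multiplicity `m j` yields an example upon composition with `exp`. -/
theorem isRamifiedExample_comp_exp {H : ℂ → ℂ} (hH : IsAnalyticOrPole H) {ω : ℂ} (hω : ω ≠ 0)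
    (hper : Function.Periodic H ω) (h0 : meromorphicOrderAt H 0 < 0) {r : ℕ}
    {c : Fin r → OnePoint ℂ} {m : Fin r → ℕ} (hc : Function.Injective c) (hm : ∀ j, 2 ≤ m j)
    (hmult : ∀ j w, sphVal H w = c j → multAt H w (c j) = (((m j : ℕ) : ℤ) : WithTop ℤ)) :
    IsRamifiedExample (fun z => H (Complex.exp z)) c m := by
  have hgan (a z : ℂ) : AnalyticAt ℂ (fun ζ => Complex.exp (ζ + a)) z := by fun_prop
  have hgd (a z : ℂ) : deriv (fun ζ => Complex.exp (ζ + a)) z ≠ 0 := by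
    have : HasDerivAt (fun ζ => Complex.exp (ζ + a)) (Complex.exp (z + a) * 1) z :=
      ((hasDerivAt_id z).add_const _).cexp
    rw [this.deriv, mul_one]
    exact Complex.exp_ne_zero _
  have htr : ∀ f ∈ translates fun z => H (Complex.exp z), IsAnalyticOrPole f ∧
      ∀ j z, sphVal f z = c j → multAt f z (c j) = (((m j : ℕ) : ℤ) : WithTop ℤ) := by
    rintro _ ⟨a, rfl⟩
    refine ⟨hH.comp (hgan a) (hgd a), fun j z hz => ?_⟩
    have h1 := hH.sphVal_comp (hgan a z) (hgd a z)
    have h2 := multAt_comp (H := H) (hgan a z) (hgd a z) (c j)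
    exact h2.trans (hmult j _ (h1.symm.trans hz))
  refine ⟨fun f hf z _ => (htr f hf).1.meromorphicAt z, fun f hf j z hz => (htr f hf).2 j z hz,
    fun D hD => ?_, fun D hD => not_isNormalFamily_translates hH hω hper h0 hD⟩
  refine
    { domain := hD
      meromorphic := fun f hf z _ => (htr f hf).1.meromorphicAt z
      zero_notMem := by simp
      injective := hc
      disjoint_AB := by simp
      disjoint_AC := by simp
      disjoint_BC := by simp
      two_le := hm
      share := by simp
      deriv_eq := by simp
      poles := fun j hj f hf z _ hz => ?_
      -- The bound 0 works: multiplicity m j makes the derivatives of orders 1, …, m j - 1 vanish.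
      deriv_le := fun j hj => ⟨0, fun f hf z _ hz k hk hkm => ?_⟩ }
  · rw [← hj]
    exact ((htr f hf).2 j z (hz.trans hj.symm)).ge
  · obtain ⟨α, hα⟩ := OnePoint.ne_infty_iff_exists.mp hj
    have hmul := (htr f hf).2 j z hz
    rw [← hα] at hz hmul
    have ha := ((htr f hf).1.analyticAt_of_sphVal_eq hz).1
    rw [derivAt_of_analyticAt ha, iteratedDeriv_eq_zero_of_multAt_eq ha hmul hk hkm, norm_zero]

/-! ### Orders of vanishing forced by a differential equation. -/

section Orders

theorem two_mul_coe_withTop (k : ℤ) : ((2 : ℕ) : WithTop ℤ) * k = ((2 * k : ℤ) : WithTop ℤ) := by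
  rw [WithTop.coe_mul]
  rfl

theorem multAt_eq_of_analyticOrderAt_eq {f : ℂ → ℂ} {w α : ℂ} (hf : AnalyticAt ℂ f w) {n : ℕ}
    (h : analyticOrderAt (fun z => f z - α) w = n) :
    multAt f w (α : OnePoint ℂ) = (((n : ℕ) : ℤ) : WithTop ℤ) := by
  have ha : AnalyticAt ℂ (fun z => f z - α) w := hf.sub analyticAt_const
  rw [multAt_coe, ha.meromorphicOrderAt_eq, h]
  rfl

/-- If `f'² = (f - e) u` with `u w ≠ 0`, then an `e`-point `w` of `f` is a double one. -/
theorem analyticOrderAt_eq_two_of_deriv_sq {f u : ℂ → ℂ} {w e : ℂ} (hf : AnalyticAt ℂ f w)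
    (hu : AnalyticAt ℂ u w) (huw : u w ≠ 0) (hfw : f w = e)
    (htop : analyticOrderAt (fun z => f z - e) w ≠ ⊤)
    (h : ∀ᶠ z in 𝓝 w, deriv f z ^ 2 = (f z - e) * u z) :
    analyticOrderAt (fun z => f z - e) w = 2 ∧ analyticOrderAt (deriv f) w = 1 := by
  have h1 := hf.analyticOrderAt_deriv_add_one
  rw [hfw] at h1
  have he : AnalyticAt ℂ (fun z => f z - e) w := hf.sub analyticAt_const
  have h2 : analyticOrderAt (deriv f ^ 2) w = analyticOrderAt ((fun z => f z - e) * u) w :=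
    analyticOrderAt_congr h
  rw [analyticOrderAt_pow hf.deriv, analyticOrderAt_mul he hu, hu.analyticOrderAt_eq_zero.mpr huw,
    add_zero] at h2
  rw [← h1] at h2 htop ⊢
  -- With k the order of f', f - e has order k + 1, and the equation gives 2k = k + 1. The constant
  -- solution f = e, of infinite order, is what `htop` rules out.
  cases hk : analyticOrderAt (deriv f) w with
  | top => simp [hk] at htop
  | coe k =>
    rw [hk] at h2
    have : 2 * k = k + 1 := by
      rw [nsmul_eq_mul] at h2
      exact_mod_cast h2
    obtain rfl : k = 1 := by lia
    exact ⟨by norm_num, by norm_num⟩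

end Orders

section Injective

theorem injective_infty_coe_coe {x y : ℂ} (hxy : x ≠ y) :
    Function.Injective ![∞, (x : OnePoint ℂ), (y : OnePoint ℂ)] := by
  intro i j hij
  fin_cases i <;> fin_cases j <;> simp_all [OnePoint.infty_ne_coe, hxy.symm]

theorem injective_infty_coe_coe_coe {x y z : ℂ} (hxy : x ≠ y) (hxz : x ≠ z) (hyz : y ≠ z) :
    Function.Injective ![∞, (x : OnePoint ℂ), (y : OnePoint ℂ), (z : OnePoint ℂ)] := by
  intro i j hij
  fin_cases i <;> fin_cases j <;>
    simp_all [OnePoint.infty_ne_coe, hxy.symm, hxz.symm, hyz.symm]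

end Injective

/-! ### The Weierstrass function and its derivative. -/

section Weierstrass

variable (L : PeriodPair)

theorem analyticAt_weierstrassP {w : ℂ} (hw : w ∉ L.lattice) : AnalyticAt ℂ L.weierstrassP w :=
  L.analyticOnNhd_weierstrassP w hw

theorem analyticAt_derivWeierstrassP {w : ℂ} (hw : w ∉ L.lattice) :
    AnalyticAt ℂ L.derivWeierstrassP w :=
  L.analyticOnNhd_derivWeierstrassP w hw

theorem eventually_notMem_lattice {w : ℂ} (hw : w ∉ L.lattice) : ∀ᶠ z in 𝓝 w, z ∉ L.lattice :=
  L.isClosed_lattice.isOpen_compl.mem_nhds hw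

theorem eventually_nhdsNE_notMem_lattice (w : ℂ) : ∀ᶠ z in 𝓝[≠] w, z ∉ L.lattice := by
  filter_upwards [self_mem_nhdsWithin,
    mem_nhdsWithin_of_mem_nhds (L.compl_lattice_sdiff_singleton_mem_nhds w)] with z hz hz'
  simp_all

theorem meromorphicOrderAt_weierstrassP_add_const (α : ℂ) {l : ℂ} (hl : l ∈ L.lattice) :
    meromorphicOrderAt (fun z => L.weierstrassP z + α) l = -2 := by
  have h := L.order_weierstrassP l hl
  refine (meromorphicOrderAt_add_eq_left_of_lt (f₁ := L.weierstrassP) (f₂ := fun _ => α)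
    (.const α l) ?_).trans h
  rw [h]
  exact lt_of_lt_of_le (by decide) analyticAt_const.meromorphicOrderAt_nonneg

/-- By the identity theorem, the finite order -2 at the pole 0 excludes infinite order anywhere in
the plane. -/
theorem analyticOrderAt_weierstrassP_sub_ne_top (α : ℂ) {w : ℂ} (hw : w ∉ L.lattice) :
    analyticOrderAt (fun z => L.weierstrassP z - α) w ≠ ⊤ := by
  intro htop
  have ha : AnalyticAt ℂ (fun z => L.weierstrassP z - α) w :=
    (analyticAt_weierstrassP L hw).sub analyticAt_const
  have hm : MeromorphicOn (fun z => L.weierstrassP z + -α) Set.univ := fun z _ =>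
    (L.meromorphic_weierstrassP z).add (.const _ _)
  refine hm.meromorphicOrderAt_ne_top_of_isPreconnected isPreconnected_univ (Set.mem_univ 0)
    (Set.mem_univ w) ?_ ?_
  · rw [meromorphicOrderAt_weierstrassP_add_const L _ L.lattice.zero_mem]
    decide
  · simp only [← sub_eq_add_neg]
    rw [ha.meromorphicOrderAt_eq, htop]
    rfl

theorem ω₁_ne_zero : L.ω₁ ≠ 0 := L.indep.ne_zero 0

theorem periodic_weierstrassP_ω₁ : Function.Periodic L.weierstrassP L.ω₁ :=
  L.periodic_weierstrassP ⟨L.ω₁, L.ω₁_mem_lattice⟩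

theorem periodic_derivWeierstrassP_ω₁ : Function.Periodic L.derivWeierstrassP L.ω₁ :=
  fun z => L.derivWeierstrassP_add_coe z ⟨L.ω₁, L.ω₁_mem_lattice⟩

variable {L}

/-! ### The cubic with roots 0, a, b and the square of `℘` when b = -a. -/

section Roots

variable {a b : ℂ}

theorem analyticAt_wpShift {w : ℂ} (hw : w ∉ L.lattice) : AnalyticAt ℂ (wpShift L a b) w :=
  (analyticAt_weierstrassP L hw).add analyticAt_const

theorem meromorphicOrderAt_wpShift {l : ℂ} (hl : l ∈ L.lattice) :
    meromorphicOrderAt (wpShift L a b) l = -2 :=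
  meromorphicOrderAt_weierstrassP_add_const L _ hl

theorem isAnalyticOrPole_wpShift : IsAnalyticOrPole (wpShift L a b) := fun w => by
  by_cases hw : w ∈ L.lattice
  · exact .inr (by rw [meromorphicOrderAt_wpShift hw]; decide)
  · exact .inl (analyticAt_wpShift hw)

theorem notMem_lattice_of_analyticAt_wpShift {w : ℂ} (h : AnalyticAt ℂ (wpShift L a b) w) :
    w ∉ L.lattice := fun hw => by
  have := h.meromorphicOrderAt_nonneg
  rw [meromorphicOrderAt_wpShift hw] at this
  exact absurd this (by decide)

theorem deriv_wpShift : deriv (wpShift L a b) = L.derivWeierstrassP := by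
  rw [← L.deriv_weierstrassP]
  ext z
  exact deriv_add_const _

theorem HasRoots.analyticOrderAt_wpShift_sub (h : HasRoots L a b) (ha : a ≠ 0) (hb : b ≠ 0)
    (hab : a ≠ b) {e w : ℂ} (he : e = 0 ∨ e = a ∨ e = b) (hw : w ∉ L.lattice)
    (hwe : wpShift L a b w = e) : analyticOrderAt (fun z => wpShift L a b z - e) w = 2 := by
  have hf := analyticAt_wpShift (a := a) (b := b) hw
  have htop : analyticOrderAt (fun z => wpShift L a b z - e) w ≠ ⊤ := by
    have := analyticOrderAt_weierstrassP_sub_ne_top L (e - (a + b) / 3) hw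
    convert this using 3 with z
    simp only [wpShift]; ring
  -- Here p and q are the other two roots; e is a simple root, so the cofactor does not vanish at w.
  have key {p q : ℂ} (hp : e ≠ p) (hq : e ≠ q) (hpq : ∀ x : ℂ, 4 * x * (x - a) * (x - b) =
      (x - e) * (4 * (x - p) * (x - q))) :
      analyticOrderAt (fun z => wpShift L a b z - e) w = 2 := by
    refine (analyticOrderAt_eq_two_of_deriv_sq hf
      (u := fun z => 4 * (wpShift L a b z - p) * (wpShift L a b z - q)) (by fun_prop) ?_ hwe htop
      ?_).1
    · simp only [hwe]
      exact mul_ne_zero (mul_ne_zero (by norm_num) (sub_ne_zero.mpr hp)) (sub_ne_zero.mpr hq)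
    · filter_upwards [eventually_notMem_lattice L hw] with z hz
      rw [deriv_wpShift, h z hz, hpq]
  rcases he with rfl | rfl | rfl
  · exact key ha.symm hb.symm fun x => by ring
  · exact key ha hab fun x => by ring
  · exact key hb hab.symm fun x => by ring

theorem HasRoots.isRamifiedExample (h : HasRoots L a b) (ha : a ≠ 0) (hb : b ≠ 0) (hab : a ≠ b) :
    IsRamifiedExample (fun z => wpShift L a b (Complex.exp z))
      ![∞, ((0 : ℂ) : OnePoint ℂ), (a : OnePoint ℂ), (b : OnePoint ℂ)] ![2, 2, 2, 2] := by
  have hH := isAnalyticOrPole_wpShift (L := L) (a := a) (b := b)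
  have hfin {e w : ℂ} (he : e = 0 ∨ e = a ∨ e = b) (hw : sphVal (wpShift L a b) w = e) :
      multAt (wpShift L a b) w e = (((2 : ℕ) : ℤ) : WithTop ℤ) := by
    obtain ⟨hw1, hw2⟩ := hH.analyticAt_of_sphVal_eq hw
    exact multAt_eq_of_analyticOrderAt_eq hw1 (h.analyticOrderAt_wpShift_sub ha hb hab he
      (notMem_lattice_of_analyticAt_wpShift hw1) hw2)
  refine isRamifiedExample_comp_exp hH (ω₁_ne_zero L)
    (fun z => congrArg (· + (a + b) / 3) (periodic_weierstrassP_ω₁ L z)) ?_ ?_ ?_ ?_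
  · rw [meromorphicOrderAt_wpShift L.lattice.zero_mem]; decide
  · exact injective_infty_coe_coe_coe ha.symm hb.symm hab
  · intro j; fin_cases j <;> simp
  · intro j w hw
    fin_cases j
    · have hl : w ∈ L.lattice := by
        by_contra hl
        exact ((analyticAt_wpShift (a := a) (b := b) hl).meromorphicOrderAt_nonneg).not_gt
          (hH.order_neg_of_sphVal_eq hw)
      change multAt _ w ∞ = _
      rw [multAt_infty, meromorphicOrderAt_wpShift hl]
      rfl
    · exact hfin (.inl rfl) hw
    · exact hfin (.inr (.inl rfl)) hw
    · exact hfin (.inr (.inr rfl)) hw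

end Roots

/-- A power of a function with an analytic-or-pole dichotomy has the same dichotomy. -/
theorem IsAnalyticOrPole.sq {H : ℂ → ℂ} (hH : IsAnalyticOrPole H) :
    IsAnalyticOrPole fun z => H z ^ 2 := fun w => by
  rcases hH w with ha | hp
  · exact .inl (ha.pow 2)
  · right
    rw [fun_meromorphicOrderAt_pow (hH.meromorphicAt w)]
    cases h : meromorphicOrderAt H w with
    | top => simp [h] at hp
    | coe k =>
      rw [h] at hp
      have : k < 0 := by exact_mod_cast hp
      rw [two_mul_coe_withTop]
      exact_mod_cast (by lia : 2 * k < 0)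

/-- Squaring doubles the orders at poles and zeros. It merges the values a and -a into a², and being
unramified at these nonzero points it leaves their multiplicity 2 unchanged. -/
theorem HasRoots.isRamifiedExample_sq {a : ℂ} (h : HasRoots L a (-a)) (ha : a ≠ 0) :
    IsRamifiedExample (fun z => L.weierstrassP (Complex.exp z) ^ 2)
      ![∞, ((0 : ℂ) : OnePoint ℂ), ((a ^ 2 : ℂ) : OnePoint ℂ)] ![4, 4, 2] := by
  have hshift : wpShift L a (-a) = L.weierstrassP := by
    ext z; simp [wpShift]
  have hP : IsAnalyticOrPole L.weierstrassP := hshift ▸ isAnalyticOrPole_wpShift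
  have hneg : a ≠ -a := fun h => ha (CharZero.eq_neg_self_iff.mp h)
  have hord {e w : ℂ} (he : e = 0 ∨ e = a ∨ e = -a) (hw : w ∉ L.lattice)
      (hwe : L.weierstrassP w = e) : analyticOrderAt (fun z => L.weierstrassP z - e) w = 2 := by
    have := h.analyticOrderAt_wpShift_sub ha (neg_ne_zero.mpr ha) hneg he hw (by rw [hshift, hwe])
    rwa [hshift] at this
  have hpole {l : ℂ} (hl : l ∈ L.lattice) :
      meromorphicOrderAt (fun z => L.weierstrassP z ^ 2) l = -4 := by
    rw [fun_meromorphicOrderAt_pow (hP.meromorphicAt l), L.order_weierstrassP l hl]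
    rfl
  have hnot {w : ℂ} (hw : AnalyticAt ℂ (fun z => L.weierstrassP z ^ 2) w) : w ∉ L.lattice :=
    fun hl => by
      have := hw.meromorphicOrderAt_nonneg
      rw [hpole hl] at this
      exact absurd this (by decide)
  refine isRamifiedExample_comp_exp (H := fun z => L.weierstrassP z ^ 2) hP.sq (ω₁_ne_zero L)
    (fun z => congrArg (· ^ 2) (periodic_weierstrassP_ω₁ L z)) ?_ ?_ ?_ ?_
  · rw [hpole L.lattice.zero_mem]; decide
  · exact injective_infty_coe_coe (pow_ne_zero 2 ha).symm
  · intro j; fin_cases j <;> simp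
  · intro j w hw
    fin_cases j
    · have hl : w ∈ L.lattice := by
        by_contra hl
        exact (((analyticAt_weierstrassP L hl).pow 2).meromorphicOrderAt_nonneg).not_gt
          (hP.sq.order_neg_of_sphVal_eq hw)
      change multAt _ w ∞ = _
      rw [multAt_infty, hpole hl]
      rfl
    · obtain ⟨hw1, hw2⟩ := hP.sq.analyticAt_of_sphVal_eq (α := 0) hw
      have hl := hnot hw1
      refine multAt_eq_of_analyticOrderAt_eq hw1 (α := 0) ?_
      have h2 := hord (.inl rfl) hl (pow_eq_zero_iff two_ne_zero |>.mp hw2)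
      simp only [sub_zero] at h2 ⊢
      change analyticOrderAt (L.weierstrassP ^ 2) w = _
      rw [analyticOrderAt_pow (analyticAt_weierstrassP L hl)]
      change 2 • analyticOrderAt (fun z => L.weierstrassP z) w = _
      rw [h2]
      rfl
    · obtain ⟨hw1, hw2⟩ := hP.sq.analyticAt_of_sphVal_eq (α := a ^ 2) hw
      have hl := hnot hw1
      refine multAt_eq_of_analyticOrderAt_eq hw1 (α := a ^ 2) ?_
      have key {e : ℂ} (he : e = a ∨ e = -a) (hwe : L.weierstrassP w = e) :
          analyticOrderAt (fun z => L.weierstrassP z ^ 2 - a ^ 2) w = 2 := by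
        have he0 : e ≠ 0 := by rcases he with rfl | rfl <;> simpa
        have hsq : e ^ 2 = a ^ 2 := by rcases he with rfl | rfl <;> ring
        have hA := analyticAt_weierstrassP L hl
        have h1 : AnalyticAt ℂ (fun z => L.weierstrassP z - e) w := hA.sub analyticAt_const
        have h2 : AnalyticAt ℂ (fun z => L.weierstrassP z + e) w := hA.add analyticAt_const
        have : (fun z => L.weierstrassP z ^ 2 - a ^ 2) =
            (fun z => L.weierstrassP z - e) * fun z => L.weierstrassP z + e := by
          ext z; simp only [Pi.mul_apply, ← hsq]; ring
        rw [this, analyticOrderAt_mul h1 h2, hord (.inr he) hl hwe,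
          h2.analyticOrderAt_eq_zero.mpr (by rw [hwe, ← two_mul]; simpa), add_zero]
      rcases sq_eq_sq_iff_eq_or_eq_neg.mp hw2 with hwe | hwe
      · exact key (.inl rfl) hwe
      · exact key (.inr rfl) hwe

/-! ### The equation `℘'² = 4℘³ + c`. -/

section Equianharmonic

variable {c : ℂ}

/-- The right-hand side of the equation has order 3 · (-2) = -6 at a lattice point, and the order of
`℘'` is half of that. -/
theorem IsEquianharmonic.meromorphicOrderAt_derivWeierstrassP (h : IsEquianharmonic L c) {l : ℂ}
    (hl : l ∈ L.lattice) : meromorphicOrderAt L.derivWeierstrassP l = -3 := by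
  have hP := L.meromorphic_weierstrassP l
  have h3 : meromorphicOrderAt (fun z => 4 * L.weierstrassP z ^ 3) l = -6 := by
    rw [fun_meromorphicOrderAt_mul (g := fun z => L.weierstrassP z ^ 3) (.const 4 l) (hP.pow 3), fun_meromorphicOrderAt_pow hP,
      L.order_weierstrassP l hl, meromorphicOrderAt_const, if_neg (by norm_num)]
    rfl
  have h6 : meromorphicOrderAt (fun z => 4 * L.weierstrassP z ^ 3 + c) l = -6 := by
    refine (meromorphicOrderAt_add_eq_left_of_lt (f₁ := fun z => 4 * L.weierstrassP z ^ 3)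
      (f₂ := fun _ => c) (.const c l) ?_).trans h3
    rw [h3]
    exact lt_of_lt_of_le (by decide) analyticAt_const.meromorphicOrderAt_nonneg
  have h2 : meromorphicOrderAt (fun z => L.derivWeierstrassP z ^ 2) l = -6 := by
    rw [← h6]
    refine meromorphicOrderAt_congr ?_
    filter_upwards [eventually_nhdsNE_notMem_lattice L l] with z hz using h z hz
  rw [fun_meromorphicOrderAt_pow (L.meromorphic_derivWeierstrassP l)] at h2
  cases hk : meromorphicOrderAt L.derivWeierstrassP l with
  | top => rw [hk] at h2; exact absurd h2 (by decide)
  | coe k =>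
    rw [hk] at h2
    rw [two_mul_coe_withTop] at h2
    have : 2 * k = -6 := WithTop.coe_injective h2
    obtain rfl : k = -3 := by lia
    rfl

theorem IsEquianharmonic.isAnalyticOrPole (h : IsEquianharmonic L c) :
    IsAnalyticOrPole L.derivWeierstrassP := fun w => by
  by_cases hw : w ∈ L.lattice
  · exact .inr (by rw [h.meromorphicOrderAt_derivWeierstrassP hw]; decide)
  · exact .inl (analyticAt_derivWeierstrassP L hw)

theorem IsEquianharmonic.meromorphicOrderAt_sq (h : IsEquianharmonic L c) {l : ℂ}
    (hl : l ∈ L.lattice) : meromorphicOrderAt (fun z => L.derivWeierstrassP z ^ 2) l = -6 := by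
  rw [fun_meromorphicOrderAt_pow (L.meromorphic_derivWeierstrassP l),
    h.meromorphicOrderAt_derivWeierstrassP hl]
  rfl

/-- `℘'² - c = 4℘³`, and `℘` has a simple zero at w because `℘'(w)² = c ≠ 0`. -/
theorem IsEquianharmonic.analyticOrderAt_sq_sub (h : IsEquianharmonic L c) (hc : c ≠ 0) {w : ℂ}
    (hw : w ∉ L.lattice) (hwc : L.derivWeierstrassP w ^ 2 = c) :
    analyticOrderAt (fun z => L.derivWeierstrassP z ^ 2 - c) w = 3 := by
  have hA := analyticAt_weierstrassP L hw
  have hP0 : L.weierstrassP w = 0 := by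
    have := h w hw
    rw [hwc] at this
    simpa using this
  have h0 : L.derivWeierstrassP w ≠ 0 := by
    intro h0
    rw [h0] at hwc
    simp [hc.symm] at hwc
  have h1 := hA.analyticOrderAt_deriv_add_one
  rw [L.deriv_weierstrassP, (analyticAt_derivWeierstrassP L hw).analyticOrderAt_eq_zero.mpr h0,
    hP0, zero_add] at h1
  simp only [sub_zero] at h1
  have h2 : (fun z => L.derivWeierstrassP z ^ 2 - c) =ᶠ[𝓝 w]
      (fun _ => (4 : ℂ)) * (fun z => L.weierstrassP z) ^ 3 := by
    filter_upwards [eventually_notMem_lattice L hw] with z hz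
    simp [h z hz]
  have h4 : AnalyticAt ℂ (fun _ => (4 : ℂ)) w := analyticAt_const
  rw [analyticOrderAt_congr h2, analyticOrderAt_mul h4 (hA.pow 3), analyticOrderAt_pow hA, ← h1,
    h4.analyticOrderAt_eq_zero.mpr (by norm_num)]
  rfl

/-- In `℘'² - c = (℘' - s)(℘' + s)` the second factor equals 2s ≠ 0 at w, so the first carries the
whole triple zero. -/
theorem IsEquianharmonic.analyticOrderAt_sub (h : IsEquianharmonic L c) (hc : c ≠ 0) {s w : ℂ}
    (hs : s ^ 2 = c) (hw : w ∉ L.lattice) (hws : L.derivWeierstrassP w = s) :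
    analyticOrderAt (fun z => L.derivWeierstrassP z - s) w = 3 := by
  have hA := analyticAt_derivWeierstrassP L hw
  have hs0 : s ≠ 0 := by rintro rfl; simp [hc.symm] at hs
  have h1 : AnalyticAt ℂ (fun z => L.derivWeierstrassP z - s) w := hA.sub analyticAt_const
  have h2 : AnalyticAt ℂ (fun z => L.derivWeierstrassP z + s) w := hA.add analyticAt_const
  have h3 := h.analyticOrderAt_sq_sub hc hw (by rw [hws, hs])
  have : (fun z => L.derivWeierstrassP z ^ 2 - c) =
      (fun z => L.derivWeierstrassP z - s) * fun z => L.derivWeierstrassP z + s := by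
    ext z; simp only [Pi.mul_apply, ← hs]; ring
  rwa [this, analyticOrderAt_mul h1 h2,
    h2.analyticOrderAt_eq_zero.mpr (by rw [hws, ← two_mul]; simpa), add_zero] at h3

/-- Where `℘'` vanishes, `℘` takes as value a root of 4x³ + c. This root is simple since c ≠ 0, so
`℘'` has a simple zero. -/
theorem IsEquianharmonic.analyticOrderAt_sq_of_eq_zero (h : IsEquianharmonic L c) (hc : c ≠ 0)
    {w : ℂ} (hw : w ∉ L.lattice) (hw0 : L.derivWeierstrassP w = 0) :
    analyticOrderAt (fun z => L.derivWeierstrassP z ^ 2) w = 2 := by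
  have hA := analyticAt_weierstrassP L hw
  set α := L.weierstrassP w with hα
  have hαc : 4 * α ^ 3 + c = 0 := by rw [← h w hw, hw0]; ring
  have hα0 : α ≠ 0 := by
    intro h0
    rw [h0] at hαc
    simp [hc] at hαc
  have h1 := (analyticOrderAt_eq_two_of_deriv_sq hA
    -- Since c = -4α³, the cubic is 4(x³ - α³), and u is its cofactor after division by x - α.
    (u := fun z => 4 * (L.weierstrassP z ^ 2 + L.weierstrassP z * α + α ^ 2)) (by fun_prop) (by
      rw [← hα, show 4 * (α ^ 2 + α * α + α ^ 2) = 12 * α ^ 2 by ring]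
      simpa) hα.symm (analyticOrderAt_weierstrassP_sub_ne_top L α hw) (by
      filter_upwards [eventually_notMem_lattice L hw] with z hz
      rw [L.deriv_weierstrassP, h z hz]
      linear_combination hαc)).2
  rw [L.deriv_weierstrassP] at h1
  change analyticOrderAt (L.derivWeierstrassP ^ 2) w = 2
  rw [analyticOrderAt_pow (analyticAt_derivWeierstrassP L hw), h1]
  rfl

theorem IsEquianharmonic.isRamifiedExample (h : IsEquianharmonic L c) (hc : c ≠ 0) {s : ℂ}
    (hs : s ^ 2 = c) :
    IsRamifiedExample (fun z => L.derivWeierstrassP (Complex.exp z))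
      ![∞, (s : OnePoint ℂ), ((-s : ℂ) : OnePoint ℂ)] ![3, 3, 3] := by
  have hH := h.isAnalyticOrPole
  have hs0 : s ≠ 0 := by rintro rfl; simp [hc.symm] at hs
  have hneg : s ≠ -s := fun h => hs0 (CharZero.eq_neg_self_iff.mp h)
  have hfin {e w : ℂ} (he : e ^ 2 = c) (hw : sphVal L.derivWeierstrassP w = e) :
      multAt L.derivWeierstrassP w e = (((3 : ℕ) : ℤ) : WithTop ℤ) := by
    obtain ⟨hw1, hw2⟩ := hH.analyticAt_of_sphVal_eq hw
    refine multAt_eq_of_analyticOrderAt_eq hw1 (h.analyticOrderAt_sub hc he (fun hl => ?_) hw2)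
    have := hw1.meromorphicOrderAt_nonneg
    rw [h.meromorphicOrderAt_derivWeierstrassP hl] at this
    exact absurd this (by decide)
  refine isRamifiedExample_comp_exp hH (ω₁_ne_zero L) (periodic_derivWeierstrassP_ω₁ L) ?_ ?_ ?_ ?_
  · rw [h.meromorphicOrderAt_derivWeierstrassP L.lattice.zero_mem]; decide
  · exact injective_infty_coe_coe hneg
  · intro j; fin_cases j <;> simp
  · intro j w hw
    fin_cases j
    · have hl : w ∈ L.lattice := by
        by_contra hl
        exact ((analyticAt_derivWeierstrassP L hl).meromorphicOrderAt_nonneg).not_gt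
          (hH.order_neg_of_sphVal_eq hw)
      change multAt _ w ∞ = _
      rw [multAt_infty, h.meromorphicOrderAt_derivWeierstrassP hl]
      rfl
    · exact hfin hs hw
    · exact hfin (by rw [neg_sq, hs]) hw

theorem IsEquianharmonic.isRamifiedExample_sq (h : IsEquianharmonic L c) (hc : c ≠ 0) :
    IsRamifiedExample (fun z => L.derivWeierstrassP (Complex.exp z) ^ 2)
      ![∞, ((0 : ℂ) : OnePoint ℂ), (c : OnePoint ℂ)] ![6, 2, 3] := by
  have hH := h.isAnalyticOrPole.sq
  have hnot {w : ℂ} (hw : AnalyticAt ℂ (fun z => L.derivWeierstrassP z ^ 2) w) : w ∉ L.lattice :=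
    fun hl => by
      have := hw.meromorphicOrderAt_nonneg
      rw [h.meromorphicOrderAt_sq hl] at this
      exact absurd this (by decide)
  refine isRamifiedExample_comp_exp (H := fun z => L.derivWeierstrassP z ^ 2) hH (ω₁_ne_zero L)
    (fun z => congrArg (· ^ 2) (periodic_derivWeierstrassP_ω₁ L z)) ?_ ?_ ?_ ?_
  · rw [h.meromorphicOrderAt_sq L.lattice.zero_mem]; decide
  · exact injective_infty_coe_coe hc.symm
  · intro j; fin_cases j <;> simp
  · intro j w hw
    fin_cases j
    · have hl : w ∈ L.lattice := by
        by_contra hl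
        exact (((analyticAt_derivWeierstrassP L hl).pow 2).meromorphicOrderAt_nonneg).not_gt
          (hH.order_neg_of_sphVal_eq hw)
      change multAt _ w ∞ = _
      rw [multAt_infty, h.meromorphicOrderAt_sq hl]
      rfl
    · obtain ⟨hw1, hw2⟩ := hH.analyticAt_of_sphVal_eq (α := 0) hw
      refine multAt_eq_of_analyticOrderAt_eq hw1 (α := 0) ?_
      simp only [sub_zero]
      exact h.analyticOrderAt_sq_of_eq_zero hc (hnot hw1) (pow_eq_zero_iff two_ne_zero |>.mp hw2)
    · obtain ⟨hw1, hw2⟩ := hH.analyticAt_of_sphVal_eq (α := c) hw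
      exact multAt_eq_of_analyticOrderAt_eq hw1 (h.analyticOrderAt_sq_sub hc (hnot hw1) hw2)

end Equianharmonic

end Weierstrass

/-! ### Existence of the required lattices. -/

section Existence

theorem exists_hasRoots {a b : ℂ} (ha : a ≠ 0) (hb : b ≠ 0) (hab : a ≠ b) :
    ∃ L : PeriodPair, HasRoots L a b := by
  set s := (a + b) / 3 with hs
  -- The numbers -s, a - s, b - s have sum 0 and are to be the roots of 4x³ - g₂x - g₃; Vieta's
  -- formulas give p and q. The discriminant p³ - 27q² is 16a²b²(a - b)².
  obtain ⟨L, h2, h3⟩ := PeriodPair.exists_invariants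
    (p := -4 * (-s * (a - s) + -s * (b - s) + (a - s) * (b - s)))
    (q := 4 * (-s * (a - s) * (b - s))) (by
      intro h
      have : 16 * a ^ 2 * b ^ 2 * (a - b) ^ 2 = 0 := by
        rw [hs] at h
        linear_combination h
      simp [ha, hb, sub_ne_zero.mpr hab] at this)
  refine ⟨L, fun z hz => ?_⟩
  rw [L.derivWeierstrassP_sq z hz, h2, h3]
  simp only [wpShift, hs]
  ring

theorem exists_isEquianharmonic {c : ℂ} (hc : c ≠ 0) : ∃ L : PeriodPair, IsEquianharmonic L c := by
  obtain ⟨L, h2, h3⟩ := PeriodPair.exists_invariants (p := 0) (q := -c) (by simpa using hc)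
  refine ⟨L, fun z hz => ?_⟩
  rw [L.derivWeierstrassP_sq z hz, h2, h3]
  ring

theorem IsRamifiedExample.admitsNonNormal {h : ℂ → ℂ} {r : ℕ} {c : Fin r → OnePoint ℂ}
    {m : Fin r → ℕ} (H : IsRamifiedExample h c m) : AdmitsNonNormal 0 0 m := fun D hD =>
  ⟨translates h, ∅, ∅, c, rfl, rfl, H.conditions D hD, H.not_normal D hD⟩

end Existence

end RamifiedFamilies

end

open RamifiedFamilies in
theorem mainTheorem8 :
    -- the Weierstrass function with `℘'² = 4 ℘ (℘ - a) (℘ - b)`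
    (∀ a b : ℂ, a ≠ 0 → b ≠ 0 → a ≠ b →
      (∃ L : PeriodPair, HasRoots L a b) ∧
      ∀ L : PeriodPair, HasRoots L a b →
        IsRamifiedExample (fun z => wpShift L a b (Complex.exp z))
          ![∞, ((0 : ℂ) : OnePoint ℂ), (a : OnePoint ℂ), (b : OnePoint ℂ)] ![2, 2, 2, 2] ∧
        (b = -a →
          IsRamifiedExample (fun z => (L.weierstrassP (Complex.exp z)) ^ 2)
            ![∞, ((0 : ℂ) : OnePoint ℂ), ((a ^ 2 : ℂ) : OnePoint ℂ)] ![4, 4, 2])) ∧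
    -- the Weierstrass function with `℘'² = 4 ℘³ + c`
    (∀ c : ℂ, c ≠ 0 →
      (∃ L : PeriodPair, IsEquianharmonic L c) ∧
      ∀ L : PeriodPair, IsEquianharmonic L c →
        (∀ s : ℂ, s ^ 2 = c →
          IsRamifiedExample (fun z => L.derivWeierstrassP (Complex.exp z))
            ![∞, (s : OnePoint ℂ), ((-s : ℂ) : OnePoint ℂ)] ![3, 3, 3]) ∧
        IsRamifiedExample (fun z => (L.derivWeierstrassP (Complex.exp z)) ^ 2)
          ![∞, ((0 : ℂ) : OnePoint ℂ), (c : OnePoint ℂ)] ![6, 2, 3]) ∧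
    -- the strict inequality `> 2` of the criterion cannot be relaxed to `≥ 2`
    (weight 0 0 ![2, 2, 2, 2] = 2 ∧ AdmitsNonNormal 0 0 ![2, 2, 2, 2]) ∧
    (weight 0 0 ![4, 4, 2] = 2 ∧ AdmitsNonNormal 0 0 ![4, 4, 2]) ∧
    (weight 0 0 ![3, 3, 3] = 2 ∧ AdmitsNonNormal 0 0 ![3, 3, 3]) ∧
    (weight 0 0 ![6, 2, 3] = 2 ∧ AdmitsNonNormal 0 0 ![6, 2, 3]) := by
  -- The choice b = -a lets a single lattice serve both (2, 2, 2, 2) and (4, 4, 2).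
  obtain ⟨L, hL⟩ := exists_hasRoots (a := 1) (b := -1) (by norm_num) (by norm_num) (by norm_num)
  obtain ⟨M, hM⟩ := exists_isEquianharmonic (c := 1) one_ne_zero
  refine ⟨fun a b ha hb hab => ⟨exists_hasRoots ha hb hab, fun L hL =>
      ⟨hL.isRamifiedExample ha hb hab, ?_⟩⟩,
    fun c hc => ⟨exists_isEquianharmonic hc, fun L hL =>
      ⟨fun s hs => hL.isRamifiedExample hc hs, hL.isRamifiedExample_sq hc⟩⟩,
    ⟨?_, (hL.isRamifiedExample (by norm_num) (by norm_num) (by norm_num)).admitsNonNormal⟩,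
    ⟨?_, (hL.isRamifiedExample_sq (by norm_num)).admitsNonNormal⟩,
    ⟨?_, (hM.isRamifiedExample one_ne_zero (one_pow 2)).admitsNonNormal⟩,
    ⟨?_, (hM.isRamifiedExample_sq one_ne_zero).admitsNonNormal⟩⟩
  · rintro rfl
    exact hL.isRamifiedExample_sq ha
  all_goals norm_num [weight, Fin.sum_univ_succ, -Finset.sum_sub_distrib]
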